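/- Let $G$ be a finite simple connected bipartite graph with $n\ge 2$ vertices, independence number $\alpha(G)$ and diameter at most $2$. Let $D(G)=(d_{uv})_{u,v\in V(G)}$ be the distance matrix of $G$, let $Tr(v)=\sum_{u\in V(G)}d_{uv}$ be the transmission of the vertex $v$, and let $D^L(G)=\operatorname{Diag}(Tr(v):v\in V(G))-D(G)$ be the distance Laplacian matrix of $G$. Let $m_{D^L(G)}(2n-1,2n)$ be the number of eigenvalues of $D^L(G)$, counted with multiplicity, that lie in the open interval $(2n-1,2n)$. Then $$m_{D^L(G)}(2n-1,2n)=\alpha(G)-1$$ if and only if $G$ is isomorphic to $H\circ K_1$ for some connected graph $H$. Here the corona $H\circ K_1$ is the graph obtained from $H$ by attaching one new pendant vertex to every vertex of $H$. -/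

import Mathlib

universe u v

namespace SimpleGraph

/-- The transmission of a vertex: the sum of its distances to all vertices. -/
noncomputable def transmission {V : Type u} [Fintype V] (G : SimpleGraph V) (v : V) : ℕ :=
  ∑ u : V, G.dist v u

/-- The distance matrix of a graph. -/
noncomputable def distMatrix {V : Type u} (G : SimpleGraph V) : Matrix V V ℝ :=
  Matrix.of fun u v => (G.dist u v : ℝ)

/-- The distance Laplacian matrix `Diag(Tr) - D(G)`. -/
noncomputable def distLapMatrix {V : Type u} [Fintype V] [DecidableEq V] (G : SimpleGraph V) :
    Matrix V V ℝ :=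
  Matrix.diagonal (fun v => (G.transmission v : ℝ)) - G.distMatrix

open Classical in
/-- The number of eigenvalues of the distance Laplacian matrix that lie in `I`, counted with
multiplicity. The matrix is real symmetric, so the roots of its characteristic polynomial
in `ℝ` are all its eigenvalues with their multiplicities. -/
noncomputable def distLapEigenvalueCount {V : Type u} [Fintype V] [DecidableEq V]
    (G : SimpleGraph V) (I : Set ℝ) : ℕ :=
  G.distLapMatrix.charpoly.roots.countP (fun x => x ∈ I)

/-- The corona `G ∘ H`: one copy of `G` and, for every vertex `i` of `G`, one copy
`{i} × H` of `H`, all of whose vertices are joined to `i`. -/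
def corona {V : Type u} {W : Type v} (G : SimpleGraph V) (H : SimpleGraph W) :
    SimpleGraph (V ⊕ V × W) where
  Adj
    | .inl i, .inl j => G.Adj i j
    | .inl i, .inr (j, _) => i = j
    | .inr (i, _), .inl j => i = j
    | .inr (i, a), .inr (j, b) => i = j ∧ H.Adj a b
  symm := by
    constructor
    rintro (i | ⟨i, a⟩) (j | ⟨j, b⟩) h
    · exact G.adj_symm h
    · exact Eq.symm h
    · exact Eq.symm h
    · exact ⟨h.1.symm, H.adj_symm h.2⟩
  loopless := by
    constructor
    rintro (i | ⟨i, a⟩) h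
    · exact G.loopless.irrefl i h
    · exact H.loopless.irrefl a h.2

end SimpleGraph

namespace SimpleGraph

/-! Diameter at most 2 makes `G` complete bipartite, and then no eigenvalue exceeds `2n - 1`
(`eq_zero_of_distLapMatrix_mulVec_eq`). The count is thus 0, and the equality says `α(G) = 1`, i.e.
`G` is complete, so `G = K₂ = K₁ ∘ K₁`. A larger `H` is excluded by a path on four vertices
(`subsingleton_of_iso_corona`). -/

/-- In a connected finite graph of diameter at most `2`, any two differently coloured vertices
of a proper `2`-colouring are adjacent. -/
lemma adj_iff_color_ne {V : Type u} [Finite V] {G : SimpleGraph V} (hconn : G.Connected)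
    (hdiam : G.diam ≤ 2) (c : G.Coloring (Fin 2)) {v w : V} : G.Adj v w ↔ c v ≠ c w := by
  refine ⟨fun h => c.valid h, fun hne => ?_⟩
  have := hconn.nonempty
  have hd : G.dist v w ≤ 2 := (dist_le_diam (connected_iff_ediam_ne_top.mp hconn)).trans hdiam
  obtain ⟨p, hp⟩ := hconn.exists_walk_length_eq_dist v w
  rw [← hp] at hd
  match p, hd with
  | .nil, _ => exact absurd rfl hne
  | .cons h .nil, _ => exact h
  | .cons h (.cons h' .nil), _ =>
    have h₁ := c.valid h
    have h₂ := c.valid h'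
    omega
  | .cons _ (.cons _ (.cons _ _)), hd => simp at hd

lemma dist_eq_two_of_color_eq {V : Type u} [Finite V] {G : SimpleGraph V} (hconn : G.Connected)
    (hdiam : G.diam ≤ 2) (c : G.Coloring (Fin 2)) {v w : V} (hc : c v = c w) (hne : v ≠ w) :
    G.dist v w = 2 := by
  have := hconn.nonempty
  have hd : G.dist v w ≤ 2 := (dist_le_diam (connected_iff_ediam_ne_top.mp hconn)).trans hdiam
  have h0 := hconn.pos_dist_of_ne hne
  have h1 : G.dist v w ≠ 1 := fun h => c.valid (dist_eq_one_iff_adj.mp h) hc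
  omega

/-- Splits off the constant 2, which vanishes against vectors with zero sum. -/
lemma cast_dist_eq {V : Type u} [Finite V] [DecidableEq V] {G : SimpleGraph V}
    (hconn : G.Connected) (hdiam : G.diam ≤ 2) (c : G.Coloring (Fin 2)) (v w : V) :
    (G.dist v w : ℝ) = 2 - (if v = w then 2 else 0) - (if c v ≠ c w then 1 else 0) := by
  by_cases hvw : v = w
  · simp [hvw]
  by_cases hc : c v = c w
  · rw [dist_eq_two_of_color_eq hconn hdiam c hc hvw]
    simp [hvw, hc]
  · rw [dist_eq_one_iff_adj.mpr ((adj_iff_color_ne hconn hdiam c).mpr hc)]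
    simp [hvw, hc]
    norm_num

lemma distLapMatrix_mulVec_apply {V : Type u} [Fintype V] [DecidableEq V] (G : SimpleGraph V)
    (x : V → ℝ) (v : V) :
    (G.distLapMatrix.mulVec x) v = (∑ w, (G.dist v w : ℝ)) * x v - ∑ w, (G.dist v w : ℝ) * x w := by
  rw [distLapMatrix, Matrix.sub_mulVec, Pi.sub_apply, Matrix.mulVec_diagonal]
  simp [transmission, Matrix.mulVec, dotProduct, distMatrix]

lemma sum_distLapMatrix_mulVec {V : Type u} [Fintype V] [DecidableEq V] (G : SimpleGraph V)
    (x : V → ℝ) : ∑ v, (G.distLapMatrix.mulVec x) v = 0 := by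
  simp_rw [distLapMatrix_mulVec_apply, Finset.sum_sub_distrib, Finset.sum_mul]
  rw [Finset.sum_comm, sub_eq_zero]
  simp_rw [dist_comm]

/-- A connected bipartite graph of diameter at most `2` on `n ≥ 2` vertices has no distance
Laplacian eigenvalue larger than `2n - 1`. -/
lemma eq_zero_of_distLapMatrix_mulVec_eq {V : Type u} [Fintype V] [DecidableEq V]
    {G : SimpleGraph V} (hcard : 2 ≤ Fintype.card V) (hconn : G.Connected) (hdiam : G.diam ≤ 2)
    (c : G.Coloring (Fin 2)) {t : ℝ} (ht : 2 * (Fintype.card V : ℝ) - 1 < t)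
    {x : V → ℝ} (hx : G.distLapMatrix.mulVec x = t • x) : x = 0 := by
  have hn : (2 : ℝ) ≤ Fintype.card V := by exact_mod_cast hcard
  have : Nontrivial V := Fintype.one_lt_card_iff_nontrivial.mp hcard
  have hS : ∑ v, x v = 0 := by
    have h := sum_distLapMatrix_mulVec G x
    simp only [hx, Pi.smul_apply, smul_eq_mul, ← Finset.mul_sum] at h
    exact (mul_eq_zero.mp h).resolve_left (by linarith)
  let e : V → V → ℝ := fun v w => if c v ≠ c w then 1 else 0
  let N : V → ℝ := fun v => ∑ w, e v w
  let T : V → ℝ := fun v => ∑ w, e v w * x w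
  -- `N v` is the size of the part opposite `v`, and `T v` the sum of `x` over it.
  have hrow (v : V) : (2 * (Fintype.card V : ℝ) - N v - t) * x v = - T v := by
    have h := congrFun hx v
    rw [distLapMatrix_mulVec_apply] at h
    simp only [cast_dist_eq hconn hdiam c, sub_mul, Finset.sum_sub_distrib, ite_mul, zero_mul,
      Finset.sum_ite_eq, Finset.mem_univ, if_true, ← Finset.mul_sum, hS, Finset.sum_const,
      Finset.card_univ, nsmul_eq_mul, Pi.smul_apply, smul_eq_mul] at h
    simp only [N, T, e, ite_mul, zero_mul]
    linarith
  have hadd {v w : V} (hvw : c v ≠ c w) (u : V) : e v u + e w u = 1 := by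
    simp only [e]
    split_ifs <;> first | (exfalso; omega) | norm_num
  have hT (w : V) : T w = 0 := by
    -- The factor `e w v` restricts to the part opposite `w`; summing over `v` there gives `(n - t)
    -- * T w = 0`, with `t > n`.
    have key : ∀ v, e w v * ((Fintype.card V + N w - t) * x v) = e w v * T w := by
      intro v
      by_cases hwv : c w = c v
      · simp [e, hwv]
      have hN : N v = Fintype.card V - N w := by
        rw [eq_sub_iff_add_eq', ← Finset.sum_add_distrib]
        simp [hadd hwv]
      have hTv : T v = - T w := by
        rw [eq_neg_iff_add_eq_zero, add_comm, ← Finset.sum_add_distrib]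
        simp [← add_mul, hadd hwv, hS]
      have h := hrow v
      rw [hN, hTv] at h
      congr 1
      linarith
    have hsum := Finset.sum_congr (rfl : (Finset.univ : Finset V) = _) fun v _ => key v
    simp_rw [mul_left_comm (e w _)] at hsum
    rw [← Finset.mul_sum, ← Finset.sum_mul] at hsum
    change (Fintype.card V + N w - t) * T w = N w * T w at hsum
    have h0 : (Fintype.card V - t) * T w = 0 := by linarith
    exact (mul_eq_zero.mp h0).resolve_left (by linarith)
  funext v
  obtain ⟨w, hw⟩ := hconn.preconnected.exists_adj_of_nontrivial v
  -- Hence `2n - N v ≤ 2n - 1 < t`, so the coefficient in `hrow` is nonzero.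
  have hNv : 1 ≤ N v := by
    have hle : e v w ≤ N v := Finset.single_le_sum (f := e v)
      (fun u _ => by simp only [e]; split_ifs <;> norm_num) (Finset.mem_univ w)
    simpa [e, c.valid hw] using hle
  have h := hrow v
  rw [hT v, neg_zero] at h
  exact (mul_eq_zero.mp h).resolve_left (by linarith)

lemma distLapEigenvalueCount_Ioo_eq_zero {V : Type u} [Fintype V] [DecidableEq V]
    {G : SimpleGraph V} (hcard : 2 ≤ Fintype.card V) (hconn : G.Connected) (hdiam : G.diam ≤ 2)
    (c : G.Coloring (Fin 2)) :
    G.distLapEigenvalueCount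
      (Set.Ioo (2 * (Fintype.card V : ℝ) - 1) (2 * (Fintype.card V : ℝ))) = 0 := by
  refine (@Multiset.countP_eq_zero _ _ (fun _ => Classical.propDecidable _) _).mpr ?_
  intro t ht hmem
  have hroot := Polynomial.isRoot_of_mem_roots ht
  rw [Polynomial.IsRoot.def, Matrix.eval_charpoly, ← Matrix.exists_mulVec_eq_zero_iff] at hroot
  obtain ⟨x, hx0, hx⟩ := hroot
  refine hx0 (eq_zero_of_distLapMatrix_mulVec_eq hcard hconn hdiam c hmem.1 ?_)
  rw [Matrix.sub_mulVec, sub_eq_zero] at hx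
  rw [← hx]
  ext v
  simp [Matrix.scalar_apply, Matrix.mulVec_diagonal]

lemma indepNum_eq_one_iff {V : Type u} [Finite V] [Nonempty V] {G : SimpleGraph V} :
    G.indepNum = 1 ↔ G = ⊤ := by
  classical
  constructor
  · intro h
    rw [eq_top_iff_forall_ne_adj]
    intro v w hvw
    by_contra hadj
    have hind : G.IsIndepSet ({v, w} : Finset V) := by
      intro a ha b hb _
      simp only [Finset.coe_insert, Finset.coe_singleton, Set.mem_insert_iff,
        Set.mem_singleton_iff] at ha hb
      rcases ha with rfl | rfl <;> rcases hb with rfl | rfl <;> simp_all [G.adj_comm]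
    have := hind.card_le_indepNum
    rw [Finset.card_pair hvw] at this
    omega
  · rintro rfl
    obtain ⟨s, hs⟩ := exists_isNIndepSet_indepNum (G := (⊤ : SimpleGraph V))
    have hle : s.card ≤ 1 := Finset.card_le_one.mpr fun a ha b hb => by
      by_contra hab
      exact hs.isIndepSet ha hb hab hab
    obtain ⟨v⟩ := ‹Nonempty V›
    have hge : ({v} : Finset V).card ≤ (⊤ : SimpleGraph V).indepNum :=
      IsIndepSet.card_le_indepNum (by simp [IsIndepSet])
    rw [Finset.card_singleton] at hge
    have := hs.card_eq
    omega

/-- The corona of a one-vertex graph with `K₁` is complete. -/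
lemma corona_eq_top_of_subsingleton {W : Type u} [Subsingleton W] (H : SimpleGraph W) :
    H.corona (⊤ : SimpleGraph (Fin 1)) = ⊤ := by
  rw [eq_top_iff_forall_ne_adj]
  rintro (i | ⟨i, a⟩) (j | ⟨j, b⟩) h
  · exact absurd (congrArg Sum.inl (Subsingleton.elim i j)) h
  · exact Subsingleton.elim i j
  · exact Subsingleton.elim i j
  · exact absurd (congrArg Sum.inr (Subsingleton.elim (i, a) (j, b))) h

/-- If any two differently coloured vertices of a properly `2`-coloured graph are adjacent and
the graph is a corona `H ∘ K₁` with `H` connected, then `H` has only one vertex. -/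
lemma subsingleton_of_iso_corona {V W : Type u} {G : SimpleGraph V} {H : SimpleGraph W}
    (c : G.Coloring (Fin 2)) (hc : ∀ {v w : V}, c v ≠ c w → G.Adj v w) (hH : H.Connected)
    (f : G ≃g H.corona (⊤ : SimpleGraph (Fin 1))) : Subsingleton W := by
  by_contra hW
  rw [not_subsingleton_iff_nontrivial] at hW
  obtain ⟨i⟩ := hH.nonempty
  obtain ⟨j, hij⟩ := hH.preconnected.exists_adj_of_nontrivial i
  have h₁ : G.Adj (f.symm (.inr (i, 0))) (f.symm (.inl i)) := f.symm.map_adj_iff.mpr rfl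
  have h₂ : G.Adj (f.symm (.inl i)) (f.symm (.inl j)) := f.symm.map_adj_iff.mpr hij
  have h₃ : G.Adj (f.symm (.inl j)) (f.symm (.inr (j, 0))) := f.symm.map_adj_iff.mpr rfl
  -- The ends of a walk of length 3 have different colours, but pendant vertices are never adjacent.
  have h₄ : G.Adj (f.symm (.inr (i, 0))) (f.symm (.inr (j, 0))) := by
    have h₁' := c.valid h₁
    have h₂' := c.valid h₂
    have h₃' := c.valid h₃
    exact hc (by omega)
  exact hij.ne (f.symm.map_adj_iff.mp h₄).1

lemma eq_top_iff_exists_iso_corona {V : Type u} [Fintype V] {G : SimpleGraph V}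
    (hcard : 2 ≤ Fintype.card V) (c : G.Coloring (Fin 2))
    (hc : ∀ {v w : V}, c v ≠ c w → G.Adj v w) :
    G = ⊤ ↔ ∃ (W : Type u) (H : SimpleGraph W), H.Connected ∧
      Nonempty (G ≃g H.corona (⊤ : SimpleGraph (Fin 1))) := by
  constructor
  · rintro rfl
    -- A colouring of a complete graph is injective.
    have hle : Fintype.card V ≤ 2 := by
      simpa using Fintype.card_le_of_injective c fun v w h => by
        by_contra hvw
        exact c.valid (show (⊤ : SimpleGraph V).Adj v w from hvw) h
    refine ⟨PUnit, ⊤, connected_top, ?_⟩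
    rw [corona_eq_top_of_subsingleton]
    exact ⟨Iso.completeGraph (Fintype.equivOfCardEq (by simp; omega))⟩
  · rintro ⟨W, H, hH, ⟨f⟩⟩
    have := subsingleton_of_iso_corona c hc hH f
    rw [eq_top_iff_forall_ne_adj]
    intro v w hvw
    rw [← f.map_adj_iff]
    exact (eq_top_iff_forall_ne_adj.mp (corona_eq_top_of_subsingleton H)) _ _ (f.injective.ne hvw)

end SimpleGraph

open SimpleGraph in
theorem mainTheorem11 {V : Type u} [Fintype V] [DecidableEq V] (G : SimpleGraph V)
    (hcard : 2 ≤ Fintype.card V) (hconn : G.Connected) (hbip : G.IsBipartite)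
    (hdiam : G.diam ≤ 2) :
    (G.distLapEigenvalueCount
        (Set.Ioo (2 * (Fintype.card V : ℝ) - 1) (2 * (Fintype.card V : ℝ))) : ℤ)
        = (G.indepNum : ℤ) - 1 ↔
      ∃ (W : Type u) (H : SimpleGraph W), H.Connected ∧
        Nonempty (G ≃g H.corona (⊤ : SimpleGraph (Fin 1))) := by
  obtain ⟨c⟩ := hbip
  have := hconn.nonempty
  rw [distLapEigenvalueCount_Ioo_eq_zero hcard hconn hdiam c,
    ← eq_top_iff_exists_iso_corona hcard c (adj_iff_color_ne hconn hdiam c).mpr,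
    ← indepNum_eq_one_iff]
  omega
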